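/- Let $m,d_1\ge 1$ and let $A\in\mathbb R^{m\times d_1}$ have rows $\mathbf a_1^{T},\dots,\mathbf a_m^{T}$, let $\|\cdot\|$ denote the spectral norm and $\|\cdot\|_F$ the Frobenius norm of a matrix, and let $\rho_A=\|A\|_F^2/\|A\|^2$ be the stable rank of $A$ (if $A=0$, quotients with denominator $\|A\|^2$ or $\|A\|_F^2$ are read as $0$). Let $\beta\in(0,1]$, $\epsilon\in(0,1)$ and $\delta>0$. Let $p_1,\dots,p_m\ge 0$ with $\sum_{t=1}^m p_t=1$ be row-sampling probabilities such that $$p_t\ \ge\ \beta\,\frac{\mathbf a_t^{T}\mathbf a_t}{\|A\|_F^2}\qquad(t=1,\dots,m).$$ Let $Q\in\mathbb R^{r\times m}$ be a random row-sampling matrix for these probabilities: its $r$ rows are independent, and each of them equals $\mathbf e_t^{T}/\sqrt{r\,p_t}$ with probability $p_t$ ($t=1,\dots,m$), where $\mathbf e_1,\dots,\mathbf e_m$ is the standard basis of $\mathbb R^m$. Put $\tilde A=QA$. If $$r\ \ge\ \frac{4\rho_A}{\beta\epsilon^2}\,\ln\frac{2d_1}{\delta},$$ then, with probability at least $1-\delta$,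 $$\|A^{T}A-\tilde A^{T}\tilde A\|\ \le\ \epsilon\,\|A\|^2 .$$ -/

import Mathlib

open MeasureTheory ProbabilityTheory
open scoped Matrix

-- From here on `‖A‖`, for a real matrix `A`, is the spectral (Euclidean operator) norm.
open scoped Matrix.Norms.L2Operator

/-- The Frobenius norm of a real matrix. -/
noncomputable def frobeniusNorm {m d : ℕ} (A : Matrix (Fin m) (Fin d) ℝ) : ℝ :=
  Matrix.frobeniusNormedAddCommGroup.toNorm.norm A

theorem frobeniusNorm_eq {m d : ℕ} (A : Matrix (Fin m) (Fin d) ℝ) :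
    frobeniusNorm A = √(∑ t, ∑ k, A t k ^ 2) := by
  unfold frobeniusNorm
  rw [Matrix.frobenius_norm_def, Real.sqrt_eq_rpow]
  simp [sq_abs]

/-- The stable (numerical) rank `ρ(A) = ‖A‖_F² / ‖A‖²`. -/
noncomputable def stableRank {m d : ℕ} (A : Matrix (Fin m) (Fin d) ℝ) : ℝ :=
  frobeniusNorm A ^ 2 / ‖A‖ ^ 2

/-- The distribution of one row of the sampling matrix:
the row equals `e_t / √(r p_t)` with probability `p_t`. -/
noncomputable def sampledRowLaw {m : ℕ} (r : ℕ) (p : Fin m → ℝ) : Measure (Fin m → ℝ) :=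
  ∑ t, ENNReal.ofReal (p t) • Measure.dirac (Pi.single t (1 / √((r : ℝ) * p t)))

/-- `Q` is a random `r × m` row-sampling matrix with row-sampling probabilities `p`:
its rows are independent and each has the law `sampledRowLaw r p`. -/
structure IsRowSampling {Ω : Type*} [MeasurableSpace Ω] (P : Measure Ω) {m r : ℕ}
    (p : Fin m → ℝ) (Q : Ω → Matrix (Fin r) (Fin m) ℝ) : Prop where
  indep : iIndepFun (fun (j : Fin r) (ω : Ω) => (Q ω).row j) P
  law : ∀ j : Fin r, HasLaw (fun ω : Ω => (Q ω).row j) (sampledRowLaw r p) P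

/-! The Gram matrix of the sample is the average of `r` independent copies of `X_t = a_t a_tᵀ /
p_t`, whose mean is `C = AᵀA`. With `L = ‖A‖_F² / β`, the condition on `p` says `0 ≤ X_t ≤ L`; hence
`X_t² ≤ L X_t`, and the variance is at most `L C ≤ L ‖A‖²`.

The tail bound is the Ahlswede–Winter form of the matrix Chernoff method, applied to `H_t = θ (X_t -
C)`. Golden–Thompson peels the summands off `tr exp (∑ H)` one at a time, each costing a factor `exp
v`, with `v = θ² L ‖A‖²` (`Matrix.sum_prod_mul_trace_exp_sum_le`, `Matrix.sum_smul_exp_le`). Since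
`exp ‖S‖ ≤ tr exp S + tr exp (-S)`, Markov's inequality gives `2 d exp (r v - a)`
(`Matrix.sum_prod_of_lt_norm_sum_le`). Probabilities are finite sums over sequences of sampled
indices. -/

open NormedSpace Filter Topology
open scoped MatrixOrder

/-! ### Trace inequalities for powers of two. -/

/-- The trace Cauchy–Schwarz inequality. -/
theorem Matrix.trace_mul_sq_le {n : Type*} [Fintype n] (A B : Matrix n n ℝ) :
    (A * B).trace ^ 2 ≤ (Aᵀ * A).trace * (Bᵀ * B).trace := by
  have h1 : (A * B).trace = ∑ x : n × n, A x.1 x.2 * B x.2 x.1 := by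
    simp [Matrix.trace, Matrix.mul_apply, Fintype.sum_prod_type]
  have h2 : (Aᵀ * A).trace = ∑ x : n × n, A x.1 x.2 ^ 2 := by
    rw [Fintype.sum_prod_type, Finset.sum_comm]
    simp [Matrix.trace, Matrix.mul_apply, sq]
  have h3 : (Bᵀ * B).trace = ∑ x : n × n, B x.2 x.1 ^ 2 := by
    rw [Fintype.sum_prod_type]
    simp [Matrix.trace, Matrix.mul_apply, sq]
  rw [h1, h2, h3]
  exact Finset.sum_mul_sq_le_sq_mul_sq _ _ _

theorem Matrix.trace_mul_pow_comm {n : Type*} [Fintype n] [DecidableEq n] (A B : Matrix n n ℝ)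
    (k : ℕ) : ((A * B) ^ k).trace = ((B * A) ^ k).trace := by
  cases k with
  | zero => simp
  | succ k =>
    have h : ∀ j : ℕ, (A * B) ^ j * A = A * (B * A) ^ j := fun j => by
      induction j with
      | zero => simp
      | succ j ih => rw [pow_succ', mul_assoc, ih, pow_succ' (B * A)]; simp only [mul_assoc]
    rw [pow_succ, ← mul_assoc, h, mul_assoc, Matrix.trace_mul_comm, mul_assoc, ← pow_succ]

theorem Matrix.trace_transpose_mul_self_pow_nonneg {n : Type*} [Fintype n] [DecidableEq n]
    (A : Matrix n n ℝ) (k : ℕ) : 0 ≤ ((Aᵀ * A) ^ k).trace := by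
  have h : (Aᵀ * A).PosSemidef := by
    simpa using Matrix.posSemidef_conjTranspose_mul_self A
  exact (h.pow k).trace_nonneg

/-- Hölder's inequality for alternating products, with exponent a power of two. -/
theorem Matrix.trace_mul_pow_two_pow_sq_le {n : Type*} [Fintype n] [DecidableEq n] (k : ℕ) :
    ∀ A B : Matrix n n ℝ, ((A * B) ^ 2 ^ k).trace ^ 2 ≤
      ((Aᵀ * A) ^ 2 ^ k).trace * ((Bᵀ * B) ^ 2 ^ k).trace := by
  induction k with
  | zero => intro A B; simpa using Matrix.trace_mul_sq_le A B
  | succ k ih =>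
    intro A B
    have hpow : ∀ M : Matrix n n ℝ, M ^ 2 ^ (k + 1) = (M * M) ^ 2 ^ k := fun M => by
      rw [pow_succ', pow_mul, pow_two]
    -- Both factors on the right of `h1` equal `tr ((AᵀA · BBᵀ) ^ 2 ^ k)` by cyclicity, so `ih`
    -- applies to them again.
    have h1 := ih (A * B) (A * B)
    rw [← pow_two (Matrix.trace _), ← hpow] at h1
    have h2 := ih (Aᵀ * A) (B * Bᵀ)
    have e1 : (((A * B)ᵀ * (A * B)) ^ 2 ^ k).trace = ((Aᵀ * A * (B * Bᵀ)) ^ 2 ^ k).trace := by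
      rw [Matrix.transpose_mul, mul_assoc, Matrix.trace_mul_pow_comm]
      simp only [mul_assoc]
    have e2 : ((B * Bᵀ) ^ 2 ^ (k + 1)).trace = ((Bᵀ * B) ^ 2 ^ (k + 1)).trace :=
      Matrix.trace_mul_pow_comm _ _ _
    simp only [Matrix.transpose_mul, Matrix.transpose_transpose] at h2
    rw [← hpow, ← hpow, e2, ← e1] at h2
    simp only [Matrix.transpose_mul] at h1 h2
    exact h1.trans h2

theorem Matrix.trace_pow_two_pow_le {n : Type*} [Fintype n] [DecidableEq n] (k : ℕ)
    (M : Matrix n n ℝ) : (M ^ 2 ^ (k + 1)).trace ≤ ((Mᵀ * M) ^ 2 ^ k).trace := by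
  have h := Matrix.trace_mul_pow_two_pow_sq_le k M M
  rw [pow_succ', pow_mul, pow_two M]
  rw [← pow_two (Matrix.trace ((Mᵀ * M) ^ 2 ^ k))] at h
  exact (le_abs_self _).trans
    (abs_le_of_sq_le_sq h (Matrix.trace_transpose_mul_self_pow_nonneg M _))

/-- Replacing `M = XY` by `MᵀM = Y X² Y`, cyclically `X² Y²`, halves the outer exponent and squares
both matrices; iterate. -/
theorem Matrix.IsSymm.trace_mul_pow_le {n : Type*} [Fintype n] [DecidableEq n] (k : ℕ) :
    ∀ {X Y : Matrix n n ℝ}, X.IsSymm → Y.IsSymm →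
      ((X * Y) ^ 2 ^ k).trace ≤ (X ^ 2 ^ k * Y ^ 2 ^ k).trace := by
  induction k with
  | zero => intro X Y _ _; simp
  | succ k ih =>
    intro X Y hX hY
    refine (Matrix.trace_pow_two_pow_le k (X * Y)).trans ?_
    rw [Matrix.transpose_mul, hX.eq, hY.eq, mul_assoc, Matrix.trace_mul_pow_comm]
    have := ih (hX.pow 2) (hY.pow 2)
    rw [← pow_mul, ← pow_mul, ← pow_succ', pow_two, pow_two] at this
    simpa only [mul_assoc] using this

/-! ### The Lie product formula and Golden–Thompson. -/

theorem norm_pow_succ_sub_pow_succ_le {𝔸 : Type*} [NormedRing 𝔸] [NormOneClass 𝔸] {x y : 𝔸} {M : ℝ}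
    (hx : ‖x‖ ≤ M) (hy : ‖y‖ ≤ M) (n : ℕ) :
    ‖x ^ (n + 1) - y ^ (n + 1)‖ ≤ (n + 1) * M ^ n * ‖x - y‖ := by
  have hM : 0 ≤ M := (norm_nonneg x).trans hx
  induction n with
  | zero => simp
  | succ n ih =>
    have e : x ^ (n + 1 + 1) - y ^ (n + 1 + 1) =
        x * (x ^ (n + 1) - y ^ (n + 1)) + (x - y) * y ^ (n + 1) := by
      rw [pow_succ' x, pow_succ' y]; noncomm_ring
    have h1 : ‖x * (x ^ (n + 1) - y ^ (n + 1))‖ ≤ M * ((n + 1) * M ^ n * ‖x - y‖) :=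
      (norm_mul_le _ _).trans (mul_le_mul hx ih (norm_nonneg _) hM)
    have h2 : ‖(x - y) * y ^ (n + 1)‖ ≤ ‖x - y‖ * M ^ (n + 1) :=
      (norm_mul_le _ _).trans (mul_le_mul_of_nonneg_left
        ((norm_pow_le _ _).trans (pow_le_pow_left₀ (norm_nonneg _) hy _)) (norm_nonneg _))
    rw [e]
    refine (norm_add_le _ _).trans ((add_le_add h1 h2).trans_eq ?_)
    push_cast; ring

theorem NormedSpace.norm_exp_le_exp_norm {𝔸 : Type*} [NormedRing 𝔸] [NormedAlgebra ℝ 𝔸]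
    [NormOneClass 𝔸] (x : 𝔸) : ‖exp x‖ ≤ Real.exp ‖x‖ := by
  rw [Real.exp_eq_exp_ℝ, exp_eq_tsum ℝ, exp_eq_tsum ℝ]
  refine tsum_of_norm_bounded (expSeries_summable' (𝕂 := ℝ) ‖x‖).hasSum fun n => ?_
  rw [norm_smul, smul_eq_mul, norm_inv, RCLike.norm_natCast]
  gcongr
  exact norm_pow_le _ _

/-- Both terms agree to first order, so the error per factor is `o(1/n)` and survives multiplication
by `n`. -/
theorem NormedSpace.hasDerivAt_exp_mul_exp_sub {𝔸 : Type*} [NormedRing 𝔸] [NormedAlgebra ℝ 𝔸]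
    [CompleteSpace 𝔸] (a b : 𝔸) :
    HasDerivAt (fun t : ℝ => exp (t • a) * exp (t • b) - exp (t • (a + b))) 0 0 := by
  have h : ∀ x : 𝔸, HasDerivAt (fun t : ℝ => exp (t • x)) x 0 := fun x => by
    simpa using hasDerivAt_exp_smul_const (𝕂 := ℝ) x (0 : ℝ)
  exact (((h a).mul (h b)).sub (h (a + b))).congr_deriv (by simp)

/-- The Lie product formula. -/
theorem NormedSpace.tendsto_exp_mul_exp_pow {𝔸 : Type*} [NormedRing 𝔸] [NormedAlgebra ℝ 𝔸]
    [CompleteSpace 𝔸] [NormOneClass 𝔸] (a b : 𝔸) :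
    Tendsto (fun n : ℕ => (exp ((n + 1 : ℝ)⁻¹ • a) * exp ((n + 1 : ℝ)⁻¹ • b)) ^ (n + 1)) atTop
      (𝓝 (exp (a + b))) := by
  have hinv : Tendsto (fun n : ℕ => ((n : ℝ) + 1)⁻¹) atTop (𝓝 0) := by
    simpa using tendsto_one_div_add_atTop_nhds_zero_nat (𝕜 := ℝ)
  have ho := (NormedSpace.hasDerivAt_exp_mul_exp_sub a b).isLittleO.comp_tendsto hinv
  have ho' : Tendsto (fun n : ℕ => ((n : ℝ) + 1) *
      ‖exp ((n + 1 : ℝ)⁻¹ • a) * exp ((n + 1 : ℝ)⁻¹ • b) - exp ((n + 1 : ℝ)⁻¹ • (a + b))‖)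
      atTop (𝓝 0) := by
    have := ho.norm_norm.tendsto_div_nhds_zero
    refine this.congr fun n => ?_
    have : (0 : ℝ) ≤ (n : ℝ) + 1 := by positivity
    simp [abs_of_nonneg this, mul_comm]
  let _ : NormedAlgebra ℚ 𝔸 := .restrictScalars ℚ ℝ 𝔸
  rw [tendsto_iff_norm_sub_tendsto_zero]
  have hb := ho'.const_mul (Real.exp (‖a‖ + ‖b‖))
  rw [mul_zero] at hb
  refine squeeze_zero (fun _ => norm_nonneg _) (fun n => ?_) hb
  set c : ℝ := ((n : ℝ) + 1)⁻¹ with hc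
  have hc0 : 0 ≤ c := by positivity
  have hcn : c * (n + 1) = 1 := inv_mul_cancel₀ (by positivity)
  have e : exp (a + b) = exp (c • (a + b)) ^ (n + 1) := by
    rw [← NormedSpace.exp_nsmul, ← Nat.cast_smul_eq_nsmul ℝ, smul_smul]
    push_cast
    rw [mul_comm, hcn, one_smul]
  have n1 : ‖exp (c • a) * exp (c • b)‖ ≤ Real.exp (c * (‖a‖ + ‖b‖)) := by
    refine (norm_mul_le _ _).trans ?_
    rw [mul_add, Real.exp_add]
    gcongr <;> refine (NormedSpace.norm_exp_le_exp_norm _).trans_eq ?_ <;>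
      rw [norm_smul, Real.norm_of_nonneg hc0]
  have n2 : ‖exp (c • (a + b))‖ ≤ Real.exp (c * (‖a‖ + ‖b‖)) := by
    refine (NormedSpace.norm_exp_le_exp_norm _).trans ?_
    rw [norm_smul, Real.norm_of_nonneg hc0]
    gcongr
    exact norm_add_le _ _
  rw [e]
  refine (norm_pow_succ_sub_pow_succ_le n1 n2 n).trans ?_
  rw [mul_comm ((n : ℝ) + 1), mul_assoc]
  gcongr
  rw [← Real.exp_nat_mul]
  gcongr
  have h1 : (n : ℝ) * c ≤ 1 := by linarith
  have h2 : 0 ≤ ‖a‖ + ‖b‖ := by positivity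
  nlinarith

/-- The Golden–Thompson inequality for real symmetric matrices. -/
theorem Matrix.IsSymm.trace_exp_add_le {n : Type*} [Fintype n] [DecidableEq n]
    {A B : Matrix n n ℝ} (hA : A.IsSymm) (hB : B.IsSymm) :
    (NormedSpace.exp (A + B)).trace ≤ (NormedSpace.exp A * NormedSpace.exp B).trace := by
  cases isEmpty_or_nonempty n
  · simp [Matrix.trace]
  have hlim := NormedSpace.tendsto_exp_mul_exp_pow A B
  -- The Lie formula has exponent `n + 1`; this subsequence makes it a power of two.
  have hidx : Tendsto (fun k : ℕ => 2 ^ k - 1) atTop atTop :=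
    (tendsto_sub_atTop_nat 1).comp (tendsto_pow_atTop_atTop_of_one_lt one_lt_two)
  have htr : Continuous (Matrix.trace : Matrix n n ℝ → ℝ) := continuous_id.matrix_trace
  refine le_of_tendsto ((htr.tendsto _).comp (hlim.comp hidx)) (Eventually.of_forall fun k => ?_)
  have hk : 2 ^ k - 1 + 1 = 2 ^ k := Nat.sub_add_cancel Nat.one_le_two_pow
  have hk' : (((2 ^ k - 1 : ℕ) : ℝ) + 1) = 2 ^ k := by exact_mod_cast hk
  simp only [Function.comp_apply, hk, hk']
  refine (Matrix.IsSymm.trace_mul_pow_le k (hA.smul _).exp (hB.smul _).exp).trans_eq ?_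
  have e : ∀ M : Matrix n n ℝ, NormedSpace.exp ((2 ^ k : ℝ)⁻¹ • M) ^ 2 ^ k = NormedSpace.exp M := fun M => by
    rw [← Matrix.exp_nsmul, ← Nat.cast_smul_eq_nsmul ℝ, smul_smul]
    simp
  rw [e, e]

/-! ### Spectral bounds on matrix exponentials. -/

theorem Matrix.IsHermitian.trace_cfc {n : Type*} [Fintype n] [DecidableEq n] {S : Matrix n n ℝ}
    (hS : S.IsHermitian) (f : ℝ → ℝ) : (cfc f S).trace = ∑ i, f (hS.eigenvalues i) := by
  rw [hS.cfc_eq, Matrix.IsHermitian.cfc, Unitary.conjStarAlgAut_apply, Matrix.trace_mul_comm,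
    ← mul_assoc]
  simp [Matrix.trace]

/-- The exponential of the norm of a symmetric matrix is dominated by a trace exponential. -/
theorem Matrix.IsHermitian.exp_norm_le_trace_exp_add {n : Type*} [Fintype n] [DecidableEq n]
    [Nonempty n] {S : Matrix n n ℝ} (hS : S.IsHermitian) :
    Real.exp ‖S‖ ≤ (NormedSpace.exp S).trace + (NormedSpace.exp (-S)).trace := by
  have hsa : IsSelfAdjoint S := hS
  have e1 : NormedSpace.exp S = cfc Real.exp S := (CFC.real_exp_eq_normedSpace_exp hsa).symm
  have e2 : NormedSpace.exp (-S) = cfc (fun x => Real.exp (-x)) S := by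
    rw [← CFC.real_exp_eq_normedSpace_exp hsa.neg, cfc_comp_neg Real.exp S]
  rw [e1, e2, hS.trace_cfc, hS.trace_cfc, ← Finset.sum_add_distrib]
  obtain ⟨⟨x, hx, hxS⟩, -⟩ := IsGreatest.norm_cfc (id : ℝ → ℝ) S
  rw [cfc_id ℝ S] at hxS
  rw [hS.spectrum_real_eq_range_eigenvalues] at hx
  obtain ⟨i, rfl⟩ := hx
  refine le_trans ?_ (Finset.single_le_sum (f := fun i => Real.exp (hS.eigenvalues i) +
    Real.exp (-hS.eigenvalues i)) (fun i _ => by positivity) (Finset.mem_univ i))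
  rw [← hxS]
  simp only [id, Real.norm_eq_abs]
  have h1 := Real.exp_pos (hS.eigenvalues i)
  have h2 := Real.exp_pos (-hS.eigenvalues i)
  rcases abs_cases (hS.eigenvalues i) with h | h <;> rw [h.1] <;> linarith

theorem Matrix.exp_le_one_add_add_mul_self {n : Type*} [Fintype n] [DecidableEq n]
    {H : Matrix n n ℝ} (h1 : -1 ≤ H) (h2 : H ≤ 1) :
    NormedSpace.exp H ≤ 1 + H + H * H := by
  have hsa : IsSelfAdjoint H := by
    have h : IsSelfAdjoint (1 - H) := IsSelfAdjoint.of_nonneg (sub_nonneg.2 h2)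
    simpa using (IsSelfAdjoint.one (Matrix n n ℝ)).sub h
  have e : cfc (fun x : ℝ => 1 + x + x * x) H = 1 + H + H * H := by
    rw [cfc_add H (fun x : ℝ => 1 + x) (fun x : ℝ => x * x), cfc_const_add 1 (fun x : ℝ => x) H,
      cfc_mul (fun x : ℝ => x) (fun x : ℝ => x) H, cfc_id' ℝ H]
    simp
  rw [← CFC.real_exp_eq_normedSpace_exp hsa, ← e]
  refine cfc_mono fun x hx => ?_
  have hx1 : -1 ≤ x := (algebraMap_le_iff_le_spectrum (r := (-1 : ℝ)) (a := H)).1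
    (by simpa using h1) x hx
  have hx2 : x ≤ 1 := (le_algebraMap_iff_spectrum_le (r := (1 : ℝ)) (a := H)).1
    (by simpa using h2) x hx
  have := (abs_le.1 (Real.abs_exp_sub_one_sub_id_le (abs_le.2 ⟨hx1, hx2⟩))).2
  nlinarith

/-- With `R = exp (S/2)` symmetric, `R (c - Z) R` is positive semidefinite and has trace `tr (exp S
(c - Z))`. -/
theorem Matrix.IsSymm.trace_exp_mul_le {n : Type*} [Fintype n] [DecidableEq n]
    {S Z : Matrix n n ℝ} (hS : S.IsSymm) {c : ℝ} (hZ : Z ≤ c • (1 : Matrix n n ℝ)) :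
    (NormedSpace.exp S * Z).trace ≤ c * (NormedSpace.exp S).trace := by
  have h2 : NormedSpace.exp S =
      NormedSpace.exp ((2 : ℝ)⁻¹ • S) * NormedSpace.exp ((2 : ℝ)⁻¹ • S) := by
    rw [← Matrix.exp_add_of_commute _ _ (Commute.refl _), ← add_smul]
    norm_num
  set R := NormedSpace.exp ((2 : ℝ)⁻¹ • S) with hR
  have hRs : Rᵀ = R := (hS.smul _).exp
  have hp : 0 ≤ (Rᴴ * (c • (1 : Matrix n n ℝ) - Z) * R).trace :=
    ((Matrix.le_iff.1 hZ).conjTranspose_mul_mul_same R).trace_nonneg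
  rw [Matrix.conjTranspose_eq_transpose_of_trivial, hRs, Matrix.mul_sub, Matrix.sub_mul,
    Matrix.trace_sub, Matrix.trace_mul_cycle R Z R, ← h2] at hp
  simp only [Matrix.mul_smul, Matrix.smul_mul, mul_one, Matrix.trace_smul, smul_eq_mul,
    ← h2] at hp
  linarith

/-! ### The matrix Chernoff bound. -/

/-- The trace moment generating function of a sum of independent, identically distributed
random symmetric matrices with finitely many values. -/
theorem Matrix.sum_prod_mul_trace_exp_sum_le {n ι : Type*} [Fintype n] [DecidableEq n] [Fintype ι]
    {p : ι → ℝ} (hp : ∀ t, 0 ≤ p t) {H : ι → Matrix n n ℝ} (hH : ∀ t, (H t).IsSymm) {c : ℝ}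
    (hc : 0 ≤ c) (hle : ∑ t, p t • NormedSpace.exp (H t) ≤ c • (1 : Matrix n n ℝ)) (r : ℕ) :
    ∑ f : Fin r → ι, (∏ j, p (f j)) * (NormedSpace.exp (∑ j, H (f j))).trace ≤
      Fintype.card n * c ^ r := by
  induction r with
  | zero => simp
  | succ r ih =>
    -- Sample `0` is averaged innermost, with the other samples fixed.
    rw [← (Fin.consEquiv fun _ => ι).sum_comp, Fintype.sum_prod_type, Finset.sum_comm]
    simp only [Fin.consEquiv_apply, Fin.prod_univ_succ, Fin.sum_univ_succ, Fin.cons_zero,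
      Fin.cons_succ]
    calc _ ≤ ∑ f : Fin r → ι, (∏ j, p (f j)) * (c * (NormedSpace.exp (∑ j, H (f j))).trace) := by
          refine Finset.sum_le_sum fun f _ => ?_
          have hS : (∑ j, H (f j)).IsSymm := by
            rw [Matrix.IsSymm, Matrix.transpose_sum]
            exact Finset.sum_congr rfl fun j _ => hH _
          have h1 := hS.trace_exp_mul_le hle
          rw [Matrix.mul_sum, Matrix.trace_sum] at h1
          have h0 : 0 ≤ ∏ j, p (f j) := Finset.prod_nonneg fun j _ => hp _
          refine le_trans ?_ (mul_le_mul_of_nonneg_left h1 h0)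
          rw [Finset.mul_sum]
          refine Finset.sum_le_sum fun t _ => ?_
          rw [Matrix.mul_smul, Matrix.trace_smul, smul_eq_mul, mul_comm (p t), mul_assoc,
            add_comm]
          exact mul_le_mul_of_nonneg_left (mul_le_mul_of_nonneg_left
            (hS.trace_exp_add_le (hH t)) (hp t)) h0
      _ = c * ∑ f : Fin r → ι, (∏ j, p (f j)) * (NormedSpace.exp (∑ j, H (f j))).trace := by
          rw [Finset.mul_sum]
          exact Finset.sum_congr rfl fun f _ => by ring
      _ ≤ c * (Fintype.card n * c ^ r) := mul_le_mul_of_nonneg_left ih hc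
      _ = _ := by ring

/-- Averaging `exp H ≤ 1 + H + H²` kills the linear term, and `1 + v ≤ exp v`. -/
theorem Matrix.sum_smul_exp_le {n ι : Type*} [Fintype n] [DecidableEq n] [Fintype ι]
    {p : ι → ℝ} (hp : ∀ t, 0 ≤ p t) (hp1 : ∑ t, p t = 1) {H : ι → Matrix n n ℝ}
    (h1 : ∀ t, -1 ≤ H t) (h2 : ∀ t, H t ≤ 1) (hmean : ∑ t, p t • H t = 0) {v : ℝ}
    (hvar : ∑ t, p t • (H t * H t) ≤ v • (1 : Matrix n n ℝ)) :
    ∑ t, p t • NormedSpace.exp (H t) ≤ Real.exp v • (1 : Matrix n n ℝ) := by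
  have key : ∑ t, p t • NormedSpace.exp (H t) ≤ ∑ t, p t • (1 + H t + H t * H t) := by
    refine Finset.sum_le_sum fun t _ => ?_
    rw [Matrix.le_iff, ← smul_sub]
    exact (Matrix.le_iff.1 (Matrix.exp_le_one_add_add_mul_self (h1 t) (h2 t))).smul (hp t)
  simp only [smul_add, Finset.sum_add_distrib, hmean, ← Finset.sum_smul, hp1, one_smul,
    add_zero] at key
  refine key.trans ((add_le_add_right hvar 1).trans ?_)
  rw [Matrix.le_iff]
  have e : Real.exp v • (1 : Matrix n n ℝ) - (1 + v • (1 : Matrix n n ℝ)) =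
      (Real.exp v - 1 - v) • 1 := by
    simp only [sub_smul, one_smul]; abel
  rw [e]
  exact Matrix.PosSemidef.one.smul (by linarith [Real.add_one_le_exp v])

/-- A matrix Chernoff bound for sums of independent, identically distributed, centred random
symmetric matrices with finitely many values. -/
theorem Matrix.sum_prod_of_lt_norm_sum_le {n ι : Type*} [Fintype n] [DecidableEq n] [Nonempty n]
    [Fintype ι] {p : ι → ℝ} (hp : ∀ t, 0 ≤ p t) (hp1 : ∑ t, p t = 1) {H : ι → Matrix n n ℝ}
    (h1 : ∀ t, -1 ≤ H t) (h2 : ∀ t, H t ≤ 1) (hmean : ∑ t, p t • H t = 0) {v : ℝ}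
    (hvar : ∑ t, p t • (H t * H t) ≤ v • (1 : Matrix n n ℝ)) (r : ℕ) (a : ℝ)
    (s : Finset (Fin r → ι)) (hs : ∀ f ∈ s, a ≤ ‖∑ j, H (f j)‖) :
    ∑ f ∈ s, ∏ j, p (f j) ≤ 2 * Fintype.card n * Real.exp (r * v - a) := by
  have hsymm : ∀ t, (H t).IsHermitian := fun t => by
    have h : IsSelfAdjoint (1 - H t) := IsSelfAdjoint.of_nonneg (sub_nonneg.2 (h2 t))
    have : IsSelfAdjoint (H t) := by simpa using (IsSelfAdjoint.one (Matrix n n ℝ)).sub h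
    exact this
  have hsymm' : ∀ t, (H t).IsSymm := fun t => by
    simpa [Matrix.IsHermitian, Matrix.IsSymm] using hsymm t
  have hw : ∀ f : Fin r → ι, 0 ≤ ∏ j, p (f j) := fun f => Finset.prod_nonneg fun j _ => hp _
  have m1 := Matrix.sum_prod_mul_trace_exp_sum_le hp hsymm' (Real.exp_nonneg v)
    (Matrix.sum_smul_exp_le hp hp1 h1 h2 hmean hvar) r
  have m2 := Matrix.sum_prod_mul_trace_exp_sum_le hp (H := fun t => -H t)
    (fun t => (hsymm' t).neg) (Real.exp_nonneg v)
    (Matrix.sum_smul_exp_le hp hp1 (fun t => neg_le_neg (h2 t)) (fun t => neg_le.1 (h1 t))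
      (by simp [hmean]) (by simpa using hvar)) r
  simp only [Finset.sum_neg_distrib] at m2
  have hpt : ∀ f : Fin r → ι, Real.exp ‖∑ j, H (f j)‖ ≤
      (NormedSpace.exp (∑ j, H (f j))).trace + (NormedSpace.exp (-∑ j, H (f j))).trace := fun f => by
    refine Matrix.IsHermitian.exp_norm_le_trace_exp_add ?_
    rw [Matrix.IsHermitian, Matrix.conjTranspose_sum]
    exact Finset.sum_congr rfl fun j _ => hsymm _
  have hmain : Real.exp a * ∑ f ∈ s, ∏ j, p (f j) ≤ 2 * Fintype.card n * Real.exp v ^ r := by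
    calc _ ≤ ∑ f ∈ s, (∏ j, p (f j)) * Real.exp ‖∑ j, H (f j)‖ := by
          rw [Finset.mul_sum]
          refine Finset.sum_le_sum fun f hf => ?_
          rw [mul_comm]
          exact mul_le_mul_of_nonneg_left (Real.exp_le_exp.2 (hs f hf)) (hw f)
      _ ≤ ∑ f : Fin r → ι, (∏ j, p (f j)) * Real.exp ‖∑ j, H (f j)‖ :=
          Finset.sum_le_univ_sum_of_nonneg fun f => mul_nonneg (hw f) (Real.exp_nonneg _)
      _ ≤ ∑ f : Fin r → ι, (∏ j, p (f j)) * ((NormedSpace.exp (∑ j, H (f j))).trace +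
            (NormedSpace.exp (-∑ j, H (f j))).trace) :=
          Finset.sum_le_sum fun f _ => mul_le_mul_of_nonneg_left (hpt f) (hw f)
      _ ≤ _ := by
          simp only [mul_add, Finset.sum_add_distrib]
          linarith
  rw [Real.exp_sub, Real.exp_nat_mul, ← mul_div_assoc, le_div_iff₀ (Real.exp_pos a), mul_comm]
  exact hmain

/-! ### Reduction to finitely many outcomes. -/

/-- The distribution on row indices underlying `sampledRowLaw`. -/
noncomputable def sampledIndexLaw {m : ℕ} (p : Fin m → ℝ) : Measure (Fin m) :=
  ∑ t, ENNReal.ofReal (p t) • Measure.dirac t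

theorem sampledIndexLaw_singleton {m : ℕ} (p : Fin m → ℝ) (t : Fin m) :
    sampledIndexLaw p {t} = ENNReal.ofReal (p t) := by
  simp [sampledIndexLaw, Measure.finsetSum_apply, Set.indicator_apply]

theorem isProbabilityMeasure_sampledIndexLaw {m : ℕ} {p : Fin m → ℝ} (hp : ∀ t, 0 ≤ p t)
    (hp1 : ∑ t, p t = 1) : IsProbabilityMeasure (sampledIndexLaw p) := by
  constructor
  simp [sampledIndexLaw, Measure.finsetSum_apply, ← ENNReal.ofReal_sum_of_nonneg fun t _ => hp t,
    hp1]

theorem map_sampledIndexLaw {m : ℕ} (r : ℕ) (p : Fin m → ℝ) :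
    (sampledIndexLaw p).map (fun t => Pi.single t (1 / √((r : ℝ) * p t))) = sampledRowLaw r p := by
  have hg : Measurable (fun t : Fin m => (Pi.single t (1 / √((r : ℝ) * p t)) : Fin m → ℝ)) :=
    measurable_of_countable _
  ext s hs
  rw [Measure.map_apply hg hs]
  simp only [sampledIndexLaw, sampledRowLaw, Measure.finsetSum_apply, Measure.smul_apply,
    Measure.dirac_apply' _ hs, Measure.dirac_apply' _ (hg hs)]
  rfl

open Classical in
/-- The probability of an event depending on a row-sampling matrix as a finite sum over the
sampled row indices. -/
theorem IsRowSampling.measureReal_preimage {Ω : Type*} [MeasurableSpace Ω] {P : Measure Ω}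
    [IsProbabilityMeasure P] {m r : ℕ} {p : Fin m → ℝ} (hp : ∀ t, 0 ≤ p t) (hp1 : ∑ t, p t = 1)
    {Q : Ω → Matrix (Fin r) (Fin m) ℝ} (hQ : IsRowSampling P p Q)
    {B : Set (Fin r → Fin m → ℝ)} (hB : MeasurableSet B) :
    P.real {ω | (fun j => (Q ω).row j) ∈ B} =
      ∑ f : Fin r → Fin m with (fun j => Pi.single (f j) (1 / √((r : ℝ) * p (f j)))) ∈ B,
        ∏ j, p (f j) := by
  have := isProbabilityMeasure_sampledIndexLaw hp hp1
  set g : Fin m → Fin m → ℝ := fun t => Pi.single t (1 / √((r : ℝ) * p t)) with hg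
  have hgm : Measurable g := measurable_of_countable _
  have hprob : IsProbabilityMeasure ((sampledIndexLaw p).map g) :=
    Measure.isProbabilityMeasure_map hgm.aemeasurable
  have hae : ∀ j, AEMeasurable (fun ω => (Q ω).row j) P := fun j => (hQ.law j).aemeasurable
  -- Independence makes the joint law of the rows a product, hence an image of the product law on
  -- indices.
  have hmap : P.map (fun ω j => (Q ω).row j) =
      (Measure.pi fun _ : Fin r => sampledIndexLaw p).map (fun f j => g (f j)) := by
    rw [(iIndepFun_iff_map_fun_eq_pi_map hae).1 hQ.indep,
      Measure.pi_map_pi (μ := fun _ : Fin r => sampledIndexLaw p) (f := fun _ => g)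
        fun _ => hgm.aemeasurable]
    congr 1
    funext j
    rw [(hQ.law j).map_eq, hg, map_sampledIndexLaw]
  have hgr : Measurable fun (f : Fin r → Fin m) (j : Fin r) => g (f j) :=
    measurable_of_countable _
  have h1 : P {ω | (fun j => (Q ω).row j) ∈ B} =
      (Measure.pi fun _ : Fin r => sampledIndexLaw p) {f | (fun j => g (f j)) ∈ B} := by
    have h2 := congrArg (fun ν => ν B) hmap
    rwa [Measure.map_apply_of_aemeasurable (aemeasurable_pi_lambda _ hae) hB,
      Measure.map_apply hgr hB] at h2
  have h3 : {f : Fin r → Fin m | (fun j => g (f j)) ∈ B} =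
      ((Finset.univ.filter fun f : Fin r → Fin m => (fun j => g (f j)) ∈ B : Finset _) :
        Set (Fin r → Fin m)) := by
    ext f; simp
  rw [measureReal_def, h1, ← measureReal_def, h3, ← sum_measureReal_singleton]
  refine Finset.sum_congr rfl fun f _ => ?_
  rw [measureReal_def, Measure.pi_singleton, ENNReal.toReal_prod]
  exact Finset.prod_congr rfl fun j _ => by
    rw [sampledIndexLaw_singleton, ENNReal.toReal_ofReal (hp _)]

/-! ### Gram matrices of sampled rows. -/

theorem Matrix.vecMulVec_self_le {n : Type*} [Fintype n] [DecidableEq n] (a : n → ℝ) :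
    Matrix.vecMulVec a a ≤ (a ⬝ᵥ a) • (1 : Matrix n n ℝ) := by
  rw [Matrix.le_iff]
  refine Matrix.PosSemidef.of_dotProduct_mulVec_nonneg ?_ fun x => ?_
  · ext i j
    simp [Matrix.vecMulVec_apply, Matrix.one_apply, eq_comm, mul_comm]
  · have h := Finset.sum_mul_sq_le_sq_mul_sq Finset.univ a x
    have e1 : x ⬝ᵥ Matrix.vecMulVec a a *ᵥ x = (∑ i, a i * x i) ^ 2 := by
      rw [Matrix.vecMulVec_mulVec, sq]
      simp only [dotProduct, op_smul_eq_smul, Pi.smul_apply, smul_eq_mul]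
      rw [Finset.sum_mul]
      exact Finset.sum_congr rfl fun i _ => by ring
    have e2 : ∀ y : n → ℝ, y ⬝ᵥ y = ∑ i, y i ^ 2 := fun y => by simp [dotProduct, sq]
    simp only [star_trivial, Matrix.sub_mulVec, dotProduct_sub, e1, Matrix.smul_mulVec,
      Matrix.one_mulVec, dotProduct_smul, smul_eq_mul, e2]
    linarith

theorem Matrix.transpose_mul_self_le {m n : Type*} [Fintype m] [Fintype n] [DecidableEq n]
    [Nonempty n] (A : Matrix m n ℝ) : Aᵀ * A ≤ ‖A‖ ^ 2 • (1 : Matrix n n ℝ) := by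
  have h : ‖Aᵀ * A‖ = ‖A‖ ^ 2 := by
    rw [sq, ← Matrix.l2_opNorm_conjTranspose_mul_self,
      Matrix.conjTranspose_eq_transpose_of_trivial]
  have hsa : IsSelfAdjoint (Aᵀ * A) := by
    have := Matrix.isHermitian_conjTranspose_mul_self A
    rwa [Matrix.conjTranspose_eq_transpose_of_trivial] at this
  rw [← h, ← Algebra.algebraMap_eq_smul_one]
  exact (le_algebraMap_iff_spectrum_le).2 fun x hx =>
    (Real.le_norm_self x).trans (spectrum.norm_le_norm_of_mem hx)

theorem Matrix.transpose_mul_self_eq_sum {m n : Type*} [Fintype m] (A : Matrix m n ℝ) :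
    Aᵀ * A = ∑ t, Matrix.vecMulVec (A t) (A t) := by
  ext i j
  simp [Matrix.mul_apply, Matrix.sum_apply, Matrix.vecMulVec_apply]

/-- The Gram matrix of a sample of rescaled rows. -/
theorem Matrix.transpose_mul_self_of_rescaled_rows {m d r : ℕ} (A : Matrix (Fin m) (Fin d) ℝ)
    {p : Fin m → ℝ} (hp : ∀ t, 0 ≤ p t) (f : Fin r → Fin m) {M : Matrix (Fin r) (Fin m) ℝ}
    (hM : ∀ j, M j = Pi.single (f j) (1 / √((r : ℝ) * p (f j)))) :
    (M * A)ᵀ * (M * A) =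
      (r : ℝ)⁻¹ • ∑ j, (p (f j))⁻¹ • Matrix.vecMulVec (A (f j)) (A (f j)) := by
  have h : ∀ j k, (M * A) j k = 1 / √((r : ℝ) * p (f j)) * A (f j) k := fun j k => by
    rw [Matrix.mul_apply, hM]
    simp [Pi.single_apply]
  ext i k
  simp only [Matrix.mul_apply (M := (M * A)ᵀ), Matrix.transpose_apply, h, Matrix.smul_apply,
    Matrix.sum_apply, Matrix.vecMulVec_apply, smul_eq_mul, Finset.mul_sum]
  refine Finset.sum_congr rfl fun j _ => ?_
  have hs : 1 / √((r : ℝ) * p (f j)) * (1 / √((r : ℝ) * p (f j))) = (r : ℝ)⁻¹ * (p (f j))⁻¹ := by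
    rw [one_div, ← mul_inv, ← mul_inv, Real.mul_self_sqrt (mul_nonneg (Nat.cast_nonneg r) (hp _))]
  linear_combination (A (f j) i * A (f j) k) * hs

/-- The tail bound for row sampling, over the finitely many outcomes. -/
theorem Matrix.sum_prod_of_lt_norm_gram_sub_le {m d r : ℕ} [Nonempty (Fin d)]
    (A : Matrix (Fin m) (Fin d) ℝ) {p : Fin m → ℝ} (hp : ∀ t, 0 ≤ p t) (hp1 : ∑ t, p t = 1)
    {L ε : ℝ} (hL : 0 < L) (hε : 0 < ε) (hε1 : ε < 1) (hrow : ∀ t, A t ⬝ᵥ A t ≤ p t * L)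
    (s : Finset (Fin r → Fin m))
    (hs : ∀ f ∈ s, ε * ‖A‖ ^ 2 ≤ ‖Aᵀ * A -
      (r : ℝ)⁻¹ • ∑ j, (p (f j))⁻¹ • Matrix.vecMulVec (A (f j)) (A (f j))‖) :
    ∑ f ∈ s, ∏ j, p (f j) ≤ 2 * d * Real.exp (-(r * (ε ^ 2 * ‖A‖ ^ 2 / (4 * L)))) := by
  set C := Aᵀ * A with hC
  set X : Fin m → Matrix (Fin d) (Fin d) ℝ :=
    fun t => (p t)⁻¹ • Matrix.vecMulVec (A t) (A t) with hX
  -- Rows of probability zero vanish, so `p_t X_t = a_t a_tᵀ` holds even where `(p t)⁻¹ = 0` by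
  -- convention.
  have hrow0 : ∀ t, p t = 0 → A t = 0 := fun t ht => by
    have h := hrow t
    rw [ht, zero_mul] at h
    have h0 : 0 ≤ A t ⬝ᵥ A t := by simpa using dotProduct_star_self_nonneg (A t)
    exact dotProduct_self_eq_zero.1 (le_antisymm h h0)
  have hpos : ∀ a : Fin d → ℝ, (0 : Matrix (Fin d) (Fin d) ℝ) ≤ Matrix.vecMulVec a a := fun a => by
    simpa using (Matrix.posSemidef_vecMulVec_self_star a).nonneg
  have hsmul : ∀ {c : ℝ} {U V : Matrix (Fin d) (Fin d) ℝ}, 0 ≤ c → U ≤ V → c • U ≤ c • V :=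
    fun {c U V} hc h => by
      rw [Matrix.le_iff, ← smul_sub]
      exact (Matrix.le_iff.1 h).smul hc
  have hsmul' : ∀ {c e : ℝ} {U : Matrix (Fin d) (Fin d) ℝ}, c ≤ e → 0 ≤ U → c • U ≤ e • U :=
    fun {c e U} hc h => by
      rw [Matrix.le_iff, ← sub_smul]
      exact (Matrix.nonneg_iff_posSemidef.1 h).smul (sub_nonneg.2 hc)
  have h1pos : (0 : Matrix (Fin d) (Fin d) ℝ) ≤ 1 := Matrix.PosSemidef.one.nonneg
  have hX0 : ∀ t, 0 ≤ X t := fun t => by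
    simpa using hsmul (inv_nonneg.2 (hp t)) (hpos (A t))
  have hinv : ∀ t, (p t)⁻¹ * (A t ⬝ᵥ A t) ≤ L := fun t => by
    rcases (hp t).eq_or_lt with h | h
    · simp [← h, hL.le]
    · rw [inv_mul_le_iff₀ h]
      exact hrow t
  have hXL : ∀ t, X t ≤ L • (1 : Matrix (Fin d) (Fin d) ℝ) := fun t => by
    refine (hsmul (inv_nonneg.2 (hp t)) (Matrix.vecMulVec_self_le (A t))).trans ?_
    rw [smul_smul]
    exact hsmul' (hinv t) h1pos
  have hpX : ∀ t, p t • X t = Matrix.vecMulVec (A t) (A t) := fun t => by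
    by_cases h : p t = 0
    · simp [hX, h, hrow0 t h]
    · simp [hX, smul_smul, mul_inv_cancel₀ h]
  have hmeanX : ∑ t, p t • X t = C := by
    simp only [hpX, hC, Matrix.transpose_mul_self_eq_sum]
  have hC0 : 0 ≤ C := by
    rw [← hmeanX]
    exact Finset.sum_nonneg fun t _ => by rw [hpX]; exact hpos _
  have hCL : C ≤ L • (1 : Matrix (Fin d) (Fin d) ℝ) := by
    rw [← hmeanX, ← one_smul ℝ (L • (1 : Matrix (Fin d) (Fin d) ℝ)), ← hp1, Finset.sum_smul]
    exact Finset.sum_le_sum fun t _ => hsmul (hp t) (hXL t)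
  have hXX : ∀ t, X t * X t ≤ L • X t := fun t => by
    have e : X t * X t = ((p t)⁻¹ * (A t ⬝ᵥ A t)) • X t := by
      simp only [hX, Matrix.smul_mul, Matrix.mul_smul, Matrix.vecMulVec_mul_vecMulVec, smul_smul]
      simp only [Matrix.vecMulVec_smul, smul_smul]
      congr 1
      ring
    rw [e]
    exact hsmul' (hinv t) (hX0 t)
  -- The variance is the second moment minus `C²`, and the latter is dropped.
  have hvarX : ∑ t, p t • ((X t - C) * (X t - C)) ≤
      (L * ‖A‖ ^ 2) • (1 : Matrix (Fin d) (Fin d) ℝ) := by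
    have e : ∑ t, p t • ((X t - C) * (X t - C)) = ∑ t, p t • (X t * X t) - C * C := by
      have : ∀ t, p t • ((X t - C) * (X t - C)) =
          p t • (X t * X t) - (p t • X t) * C - C * (p t • X t) + p t • (C * C) := fun t => by
        simp only [sub_mul, mul_sub, Matrix.smul_mul, Matrix.mul_smul, smul_sub]
        abel
      simp only [this, Finset.sum_add_distrib, Finset.sum_sub_distrib, ← Finset.sum_mul,
        ← Finset.mul_sum, ← Finset.sum_smul, hmeanX, hp1, one_smul]
      abel
    have hCC : 0 ≤ C * C := by
      have h : Cᴴ * C = C * C := by rw [(Matrix.nonneg_iff_posSemidef.1 hC0).isHermitian.eq]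
      rw [← h]
      exact (Matrix.posSemidef_conjTranspose_mul_self C).nonneg
    rw [e, mul_smul]
    calc _ ≤ ∑ t, p t • (X t * X t) := sub_le_self _ hCC
      _ ≤ ∑ t, p t • (L • X t) := Finset.sum_le_sum fun t _ => hsmul (hp t) (hXX t)
      _ = L • C := by
        rw [← hmeanX, Finset.smul_sum]
        exact Finset.sum_congr rfl fun t _ => smul_comm _ _ _
      _ ≤ _ := hsmul hL.le (Matrix.transpose_mul_self_le A)
  -- This `θ` minimises the exponent per sample, `θ² L ‖A‖² - θ ε ‖A‖²`; `ε < 1` ensures `θ L ≤ 1`.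
  set θ : ℝ := ε / (2 * L) with hθ
  have hθ0 : 0 < θ := by positivity
  have hθL : θ * L ≤ 1 := by
    rw [hθ, div_mul_eq_mul_div, div_le_one (by positivity)]
    nlinarith
  have hone : (θ * L) • (1 : Matrix (Fin d) (Fin d) ℝ) ≤ 1 := by
    simpa using hsmul' hθL h1pos
  have hlow : ∀ t, -1 ≤ θ • (X t - C) := fun t => by
    have h : C - X t ≤ L • 1 := (sub_le_self _ (hX0 t)).trans hCL
    have h' := (hsmul hθ0.le h).trans ((smul_smul θ L _).trans_le hone)
    rw [← neg_sub C, smul_neg]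
    exact neg_le_neg h'
  have hup : ∀ t, θ • (X t - C) ≤ 1 := fun t =>
    (hsmul hθ0.le ((sub_le_self _ hC0).trans (hXL t))).trans ((smul_smul θ L _).trans_le hone)
  have hmean : ∑ t, p t • θ • (X t - C) = 0 := by
    simp only [smul_comm _ θ, ← Finset.smul_sum, smul_sub, Finset.sum_sub_distrib, hmeanX,
      ← Finset.sum_smul, hp1, one_smul, sub_self]
  have hvar : ∑ t, p t • ((θ • (X t - C)) * (θ • (X t - C))) ≤
      (θ * θ * (L * ‖A‖ ^ 2)) • (1 : Matrix (Fin d) (Fin d) ℝ) := by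
    have e : ∑ t, p t • ((θ • (X t - C)) * (θ • (X t - C))) =
        (θ * θ) • ∑ t, p t • ((X t - C) * (X t - C)) := by
      rw [Finset.smul_sum]
      refine Finset.sum_congr rfl fun t _ => ?_
      simp only [Matrix.smul_mul, Matrix.mul_smul, smul_smul]
      congr 1
      ring
    rw [e, mul_smul (θ * θ)]
    exact hsmul (by positivity) hvarX
  have hmain := Matrix.sum_prod_of_lt_norm_sum_le hp hp1 hlow hup hmean hvar r
    (θ * (r * (ε * ‖A‖ ^ 2))) s fun f hf => by
      -- For `r = 0` the threshold is `0`; otherwise `r * r⁻¹ = 1` is available.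
      rcases Nat.eq_zero_or_pos r with h0 | h0
      · simp [h0]
      have hr : (0 : ℝ) < r := by exact_mod_cast h0
      have e : ∑ j, θ • (X (f j) - C) = (-(θ * r)) • (C - (r : ℝ)⁻¹ • ∑ j, X (f j)) := by
        rw [← Finset.smul_sum, Finset.sum_sub_distrib, Finset.sum_const, Finset.card_univ,
          Fintype.card_fin, ← Nat.cast_smul_eq_nsmul ℝ, smul_sub (-(θ * r)), smul_smul,
          smul_sub θ, smul_smul]
        have : -(θ * r) * (r : ℝ)⁻¹ = -θ := by field_simp
        rw [this]
        module
      rw [e, norm_smul, Real.norm_eq_abs, abs_neg, abs_of_pos (mul_pos hθ0 hr), mul_assoc]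
      gcongr
      exact hs f hf
  refine hmain.trans_eq ?_
  rw [Fintype.card_fin]
  congr 2
  rw [hθ]
  field_simp
  ring

/-! ### The sampling theorem. -/

theorem mainTheorem4 {Ω : Type*} [MeasurableSpace Ω] (P : Measure Ω) [IsProbabilityMeasure P]
    {m d₁ r : ℕ} (A : Matrix (Fin m) (Fin d₁) ℝ)
    (β ε δ : ℝ) (hβ : 0 < β) (hβ_le : β ≤ 1) (hε : 0 < ε) (hε_lt : ε < 1) (hδ : 0 < δ)
    (p : Fin m → ℝ) (hp_nonneg : ∀ t, 0 ≤ p t) (hp_sum : ∑ t, p t = 1)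
    (hp : ∀ t, β * ((A.row t ⬝ᵥ A.row t) / frobeniusNorm A ^ 2) ≤ p t)
    (hr : 4 * stableRank A / (β * ε ^ 2) * Real.log (2 * (d₁ : ℝ) / δ) ≤ (r : ℝ))
    (Q : Ω → Matrix (Fin r) (Fin m) ℝ) (hQ : IsRowSampling P p Q) :
    1 - δ ≤ P.real {ω | ‖Aᵀ * A - (Q ω * A)ᵀ * (Q ω * A)‖ ≤ ε * ‖A‖ ^ 2} := by
  classical
  by_cases hA : A = 0
  · simp [hA, hδ.le]
  have hd : Nonempty (Fin d₁) := by
    by_contra h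
    rw [not_nonempty_iff] at h
    exact hA (Matrix.ext fun _ k => h.elim k)
  have hs : 0 < ‖A‖ ^ 2 := by have := norm_pos_iff.2 hA; positivity
  have hF0 : frobeniusNorm A ≠ 0 :=
    (@norm_ne_zero_iff _ Matrix.frobeniusNormedAddCommGroup.toNormedAddGroup A).2 hA
  have hF : 0 < frobeniusNorm A ^ 2 := by positivity
  set L := frobeniusNorm A ^ 2 / β with hL
  have hL0 : 0 < L := by positivity
  have hrow : ∀ t, A t ⬝ᵥ A t ≤ p t * L := fun t => by
    have h := hp t
    rw [hL, mul_div_assoc', le_div_iff₀ hβ]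
    rw [mul_div_assoc', div_le_iff₀ hF] at h
    rw [mul_comm]
    exact h
  let G : (Fin r → Fin m → ℝ) → ℝ := fun M =>
    ‖Aᵀ * A - (Matrix.of M * A)ᵀ * (Matrix.of M * A)‖
  have hG : Continuous G := by
    have h1 : Continuous fun M : Fin r → Fin m → ℝ => Matrix.of M * A :=
      Continuous.matrix_mul continuous_id continuous_const
    exact (continuous_const.sub (h1.matrix_transpose.matrix_mul h1)).norm
  have hB : MeasurableSet {M | ε * ‖A‖ ^ 2 < G M} := measurableSet_lt measurable_const hG.measurable
  have hbad := hQ.measureReal_preimage hp_nonneg hp_sum hB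
  have htail := Matrix.sum_prod_of_lt_norm_gram_sub_le A hp_nonneg hp_sum hL0 hε hε_lt hrow
    (Finset.univ.filter fun f : Fin r → Fin m =>
      (fun j => Pi.single (f j) (1 / √((r : ℝ) * p (f j)))) ∈ {M | ε * ‖A‖ ^ 2 < G M})
    fun f hf => by
      have h := (Finset.mem_filter.1 hf).2
      rw [← Matrix.transpose_mul_self_of_rescaled_rows A hp_nonneg f
        (M := Matrix.of fun j => Pi.single (f j) (1 / √((r : ℝ) * p (f j)))) fun j => rfl]
      exact le_of_lt h
  have hd0 : (0 : ℝ) < d₁ := by exact_mod_cast Fin.pos_iff_nonempty.2 hd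
  have hexp : 2 * d₁ * Real.exp (-(r * (ε ^ 2 * ‖A‖ ^ 2 / (4 * L)))) ≤ δ := by
    have hk : 0 < ε ^ 2 * ‖A‖ ^ 2 / (4 * L) := by positivity
    -- The coefficient `4 ρ_A / (β ε²)` in `hr` is exactly the inverse of `ε² ‖A‖² / (4 L)`.
    have h1 : Real.log (2 * d₁ / δ) ≤ r * (ε ^ 2 * ‖A‖ ^ 2 / (4 * L)) := by
      refine le_trans (le_of_eq ?_) (mul_le_mul_of_nonneg_right hr hk.le)
      rw [stableRank, hL]
      field_simp
    have h2 := Real.exp_le_exp.2 h1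
    rw [Real.exp_log (by positivity), div_le_iff₀ hδ] at h2
    rw [Real.exp_neg, ← div_eq_mul_inv, div_le_iff₀ (Real.exp_pos _), mul_comm δ]
    exact h2
  have hle : P.real {ω | (fun j => (Q ω).row j) ∈ {M | ε * ‖A‖ ^ 2 < G M}} ≤ δ :=
    (hbad.trans_le htail).trans hexp
  -- Subadditivity replaces the complement rule, which would need measurability of the event.
  have hcover : (1 : ℝ) ≤ P.real {ω | ‖Aᵀ * A - (Q ω * A)ᵀ * (Q ω * A)‖ ≤ ε * ‖A‖ ^ 2} +
      P.real {ω | (fun j => (Q ω).row j) ∈ {M | ε * ‖A‖ ^ 2 < G M}} := by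
    rw [← probReal_univ (μ := P)]
    refine le_trans (measureReal_mono fun ω _ => ?_) (measureReal_union_le _ _)
    exact le_or_gt ‖Aᵀ * A - (Q ω * A)ᵀ * (Q ω * A)‖ (ε * ‖A‖ ^ 2)
  linarith
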